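/- **Definitions.** $\mathcal{HG}$ is the category of finite directed hypergraphs: an object $G=(V,E)$ is a finite set $V$ with a set $E$ of pairs $e=(T_e,H_e)$, $T_e,H_e\subseteq V$; a morphism $h:G_1\to G_2$ is a map $h:V_1\to V_2$ such that $(h(T_e),h(H_e))\in E_2$ for every $e\in E_1$. $\mathcal C$ is a modular tensor category over $\mathbb C$: a $\mathbb C$-linear abelian, semisimple, rigid monoidal category with finite-dimensional Hom spaces, finitely many simple objects up to isomorphism, bilinear tensor product and simple unit, with a braiding $c$ and a compatible ribbon twist $\theta$, such that the matrix $S_{ij}=\operatorname{tr}(c_{X_j,X_i}\circ c_{X_i,X_j})$ over the simple objects is invertible. **(A) Values in $\mathcal C$.** An *embedding functor* is a functor $\Phi:\mathcal{HG}\to\mathcal C$, together with a simple object $X_v$ of $\mathcal C$ for every vertex $v$ of every hypergraph $G$ and identifications $\Phi(G)\cong\bigoplus_{v\in V}X_v$, such that for every $h:G_1\to G_2$ and every vertex $v$ of $G_1$ the morphism $\Phi(h)$ sends the summand $X_v$ into the summand $X_{h(v)}$ by a nonzero morphism. **(B) Values in subcategories of $\mathcal C$.** Let $G$ range over finite directed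 hypergraphs whose vertices $v$ are labelled by pairwise non-isomorphic simple objects $X_v$ of $\mathcal C$, and let $\mathcal C_G\subseteq\mathcal C$ be the full subcategory of finite direct sums of objects $X_v$, $v\in V$. A *subcategory embedding* assigns to every homomorphism $h:G_1\to G_2$ of the underlying hypergraphs a $\mathbb C$-linear functor $\Phi(h):\mathcal C_{G_1}\to\mathcal C_{G_2}$ with $\Phi(h)(X_v)\cong X_{h(v)}$ for all $v$, such that $\Phi(\mathrm{id})\cong\mathrm{id}$ and $\Phi(k\circ h)\cong\Phi(k)\circ\Phi(h)$. **Proposition.** Let $\mathcal C$ be a modular tensor category over $\mathbb C$. 1. For every simple object $X$ of $\mathcal C$ there is an embedding functor $\Phi:\mathcal{HG}\to\mathcal C$ with $X_v=X$ for all vertices $v$. 2. Every embedding functor $\Phi:\mathcal{HG}\to\mathcal C$ is faithful: $\operatorname{Hom}_{\mathcal{HG}}(G_1,G_2)\to\operatorname{Hom}_{\mathcal C}(\Phi(G_1),\Phi(G_2))$ is injective. Moreover, if $h$ is injective on vertices, then $\Phi(h)$ is a monomorphism. 3. There is a subcategory embedding. 4. Every subcategory embedding is faithful: if $h,h':G_1\to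 G_2$ and $\Phi(h)\cong\Phi(h')$ as functors $\mathcal C_{G_1}\to\mathcal C_{G_2}$, then $h=h'$. Moreover, if $h$ is injective on vertices, then $\Phi(h)$ is full and faithful. -/

import Mathlib

open CategoryTheory CategoryTheory.Limits CategoryTheory.MonoidalCategory

universe w v u

attribute [instance] Abelian.hasFiniteBiproducts

namespace DataFabric

/-! ### Directed hypergraphs -/

/-- A (finite) directed hypergraph: a finite vertex set `V` and a set of hyperedges `(T, H)`,
each consisting of a tail `T ⊆ V` and a head `H ⊆ V`. -/
structure DirHypergraph : Type (w + 1) where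
  V : Type w
  finite : Finite V
  edges : Set (Set V × Set V)

attribute [instance] DirHypergraph.finite

/-- A homomorphism of directed hypergraphs: a map of vertices that sends every hyperedge
`(T, H)` of the source to a hyperedge `(h(T), h(H))` of the target. -/
@[ext]
structure DirHypergraph.Hom (G₁ G₂ : DirHypergraph.{w}) : Type w where
  toFun : G₁.V → G₂.V
  map_edge : ∀ e ∈ G₁.edges, (toFun '' e.1, toFun '' e.2) ∈ G₂.edges

/-- The category `HG` of directed hypergraphs, with composition of vertex maps. -/
instance : Category DirHypergraph.{w} where
  Hom := DirHypergraph.Hom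
  id G := ⟨id, fun e he => by simpa using he⟩
  comp h k := ⟨k.toFun ∘ h.toFun, fun e he => by
    simpa only [Set.image_comp] using k.map_edge _ (h.map_edge e he)⟩

/-! ### Modular tensor categories -/

/-- A ribbon structure (twist) on a rigid braided monoidal category. -/
class RibbonCategory (C : Type u) [Category.{v} C] [MonoidalCategory C] [BraidedCategory C]
    [RigidCategory C] where
  /-- The twist `θ_X : X ≅ X`. -/
  twist : ∀ X : C, X ≅ X
  twist_naturality : ∀ {X Y : C} (f : X ⟶ Y), f ≫ (twist Y).hom = (twist X).hom ≫ f
  /-- `θ_{X ⊗ Y} = c_{Y,X} ∘ c_{X,Y} ∘ (θ_X ⊗ θ_Y)`. -/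
  twist_tensor : ∀ X Y : C, (twist (X ⊗ Y)).hom =
    ((twist X).hom ⊗ₘ (twist Y).hom) ≫ (β_ X Y).hom ≫ (β_ Y X).hom
  /-- `θ_{X*} = (θ_X)*`. -/
  twist_dual : ∀ X : C, (twist (Xᘁ)).hom = (twist X).homᘁ

section

variable {C : Type u} [Category.{v} C] [MonoidalCategory C] [BraidedCategory C]
  [RigidCategory C] [RibbonCategory C]

/-- The quantum trace of an endomorphism `f` of `X`, as an endomorphism of the unit object:
`ev_X ∘ c_{X,X*} ∘ ((θ_X ∘ f) ⊗ id_{X*}) ∘ coev_X`. -/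
def quantumTrace {X : C} (f : X ⟶ X) : 𝟙_ C ⟶ 𝟙_ C :=
  η_ X Xᘁ ≫ ((f ≫ (RibbonCategory.twist X).hom) ▷ Xᘁ) ≫ (β_ X Xᘁ).hom ≫ ε_ X Xᘁ

end

/-- A finite family of pairwise non-isomorphic simple objects that represents every isomorphism
class of simple objects. -/
structure IsCompleteSimpleFamily {C : Type u} [Category.{v} C] [HasZeroMorphisms C] {n : ℕ}
    (S : Fin n → C) : Prop where
  simple : ∀ i, Simple (S i)
  not_iso : ∀ i j, Nonempty (S i ≅ S j) → i = j
  complete : ∀ Y : C, Simple Y → ∃ i, Nonempty (Y ≅ S i)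

/-- A modular tensor category over `ℂ`: a ribbon fusion category (finite, semisimple, abelian,
`ℂ`-linear, rigid, with finite-dimensional morphism spaces, bilinear tensor product and simple
unit) whose `S`-matrix `S_{ij} = tr(c_{X_j,X_i} ∘ c_{X_i,X_j})`, indexed by the isomorphism
classes of simple objects, is invertible. -/
class ModularTensorCategory (C : Type u) [Category.{v} C] [Abelian C] [Linear ℂ C]
    [MonoidalCategory C] [MonoidalPreadditive C] [MonoidalLinear ℂ C] [BraidedCategory C]
    [RigidCategory C] [RibbonCategory C] : Prop where
  finiteDimensional_hom : ∀ X Y : C, FiniteDimensional ℂ (X ⟶ Y)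
  simple_unit : Simple (𝟙_ C)
  semisimple : ∀ Y : C, ∃ (n : ℕ) (S : Fin n → C), (∀ i, Simple (S i)) ∧ Nonempty (Y ≅ ⨁ S)
  modular : ∃ (n : ℕ) (X : Fin n → C) (S : Matrix (Fin n) (Fin n) ℂ),
    IsCompleteSimpleFamily X ∧
    (∀ i j, S i j • 𝟙 (𝟙_ C) = quantumTrace ((β_ (X i) (X j)).hom ≫ (β_ (X j) (X i)).hom)) ∧
    IsUnit S

/-! ### The embedding functor, with values in the category `C` -/

/-- An embedding functor `Φ : HG ⥤ C`. Every vertex `v` of a hypergraph `G` has a simple object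
`X_v`, the object `Φ(G)` is the direct sum `⨁ X_v` over the vertices of `G`, and `Φ(h)` sends
the summand `X_v` to the summand `X_{h(v)}` by a nonzero morphism. -/
structure HypergraphEmbedding (C : Type u) [Category.{v} C] [Abelian C] where
  functor : DirHypergraph.{w} ⥤ C
  vertexObj : ∀ G : DirHypergraph.{w}, G.V → C
  vertexObj_simple : ∀ (G : DirHypergraph.{w}) (x : G.V), Simple (vertexObj G x)
  objIso : ∀ G : DirHypergraph.{w}, functor.obj G ≅ ⨁ vertexObj G
  map_vertex : ∀ {G₁ G₂ : DirHypergraph.{w}} (h : G₁ ⟶ G₂) (x : G₁.V),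
    ∃ a : vertexObj G₁ x ⟶ vertexObj G₂ (h.toFun x), a ≠ 0 ∧
      biproduct.ι (vertexObj G₁) x ≫ (objIso G₁).inv ≫ functor.map h ≫ (objIso G₂).hom =
        a ≫ biproduct.ι (vertexObj G₂) (h.toFun x)

/-! ### The embedding, with values in subcategories of `C` -/

/-- A directed hypergraph whose vertices are labelled by pairwise non-isomorphic simple objects
of `C`. -/
structure LabelledHypergraph (C : Type u) [Category.{v} C] [HasZeroMorphisms C] where
  graph : DirHypergraph.{w}
  label : graph.V → C
  simple : ∀ x, Simple (label x)
  not_iso : ∀ x y, Nonempty (label x ≅ label y) → x = y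

section

variable {C : Type u} [Category.{v} C] [Abelian C]

/-- The objects that are finite direct sums of the labels of the vertices. -/
def LabelledHypergraph.isSum (L : LabelledHypergraph.{w} C) : ObjectProperty C := fun Y =>
  ∃ (n : ℕ) (f : Fin n → L.graph.V), Nonempty (Y ≅ ⨁ fun i => L.label (f i))

/-- The subcategory `C_G ⊆ C` generated by the simple objects `X_v`, `v` a vertex of `G`. -/
abbrev LabelledHypergraph.Subcat (L : LabelledHypergraph.{w} C) : Type u :=
  L.isSum.FullSubcategory

theorem LabelledHypergraph.isSum_label (L : LabelledHypergraph.{w} C) (x : L.graph.V) :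
    L.isSum (L.label x) :=
  ⟨1, fun _ => x, ⟨(biproductUniqueIso (fun _ : Fin 1 => L.label x)).symm⟩⟩

/-- The label `X_v` as an object of `C_G`. -/
def LabelledHypergraph.vertexObj (L : LabelledHypergraph.{w} C) (x : L.graph.V) : L.Subcat :=
  ⟨L.label x, L.isSum_label x⟩

end

/-- An assignment, functorial up to natural isomorphism, of a `ℂ`-linear functor
`Φ(h) : C_{G₁} ⥤ C_{G₂}` with `Φ(h)(X_v) ≅ X_{h(v)}` to every homomorphism `h : G₁ ⟶ G₂` of
hypergraphs whose vertices are labelled by pairwise non-isomorphic simple objects. -/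
structure SubcategoryEmbedding (C : Type u) [Category.{v} C] [Abelian C] [Linear ℂ C] where
  map : ∀ (L₁ L₂ : LabelledHypergraph.{w} C), (L₁.graph ⟶ L₂.graph) → (L₁.Subcat ⥤ L₂.Subcat)
  additive : ∀ (L₁ L₂ : LabelledHypergraph.{w} C) (h : L₁.graph ⟶ L₂.graph),
    (map L₁ L₂ h).Additive
  linear : ∀ (L₁ L₂ : LabelledHypergraph.{w} C) (h : L₁.graph ⟶ L₂.graph),
    (map L₁ L₂ h).Linear ℂ
  map_vertex : ∀ (L₁ L₂ : LabelledHypergraph.{w} C) (h : L₁.graph ⟶ L₂.graph) (x : L₁.graph.V),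
    Nonempty ((map L₁ L₂ h).obj (L₁.vertexObj x) ≅ L₂.vertexObj (h.toFun x))
  map_id : ∀ L : LabelledHypergraph.{w} C, Nonempty (map L L (𝟙 L.graph) ≅ 𝟭 L.Subcat)
  map_comp : ∀ (L₁ L₂ L₃ : LabelledHypergraph.{w} C) (h : L₁.graph ⟶ L₂.graph)
    (k : L₂.graph ⟶ L₃.graph),
    Nonempty (map L₁ L₃ (h ≫ k) ≅ map L₁ L₂ h ⋙ map L₂ L₃ k)

end DataFabric

open DataFabric

/-!
A homomorphism of hypergraphs is determined by its vertex map, and a morphism between direct sums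
of simple objects by its components. By Schur's lemma these are zero or isomorphisms, and since the
morphism spaces are finite-dimensional over `ℂ`, the endomorphisms of a simple object are scalars.

For functors with values in `C`, the vertex `h(x)` can be read off from `Φ(h)` as the only summand
that receives a nonzero component from `X_x`, so `Φ` is faithful. If `h` is injective, the inverses
of these components form a retraction of `Φ(h)` (`HypergraphEmbedding.mono_map`). With one label
`X` for all vertices, `Φ(h)` can be taken to have the identity of `X` as its components.

For subcategories, Schur's lemma identifies `C_G` with a category `FormalSum V` of complex matrices
whose rows and columns are labelled by vertices and whose entries vanish between different labels
(`LabelledHypergraph.realize_isEquivalence`). On the matrix side a vertex map acts by changing the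
labels and keeping the matrices, which is strictly functorial and linear; transporting this along
the equivalences gives a subcategory embedding (`SubcategoryEmbedding.ofRelabel`). Conversely, any
`Φ(h)` recovers `h(x)` as the vertex labelled by `Φ(h)(X_x)`. If `h` is injective, `Φ(h)` is
bijective on morphisms between labels, hence on morphisms between all direct sums of labels
(`map_bijective_of_decomposition`).
-/

namespace DataFabric

/-! ### Schur's lemma over the complex numbers -/

section Schur

variable {C : Type u} [Category.{v} C] [Abelian C]

theorem exists_eq_smul_id_of_simple [Linear ℂ C] {X : C} (hX : Simple X)
    [FiniteDimensional ℂ (X ⟶ X)] (f : X ⟶ X) : ∃ c : ℂ, f = c • 𝟙 X := by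
  obtain ⟨c, hc⟩ := endomorphism_simple_eq_smul_id ℂ f
  exact ⟨c, hc.symm⟩

theorem LabelledHypergraph.hom_eq_zero (L : LabelledHypergraph.{w} C) {x y : L.graph.V}
    (hxy : x ≠ y) (f : L.label x ⟶ L.label y) : f = 0 := by
  have := L.simple x
  have := L.simple y
  by_contra hf
  have := isIso_of_hom_simple hf
  exact hxy (L.not_iso x y ⟨asIso f⟩)

end Schur

/-! ### Embedding functors with values in the category -/

section Embedding

variable {C : Type u} [Category.{v} C] [Abelian C]

/-- The embedding functor that labels every vertex by the simple object `X`: a homomorphism acts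
by permuting and merging the summands of `⨁ X`. -/
noncomputable def HypergraphEmbedding.const (X : C) (hX : Simple X) :
    HypergraphEmbedding.{w} C where
  functor :=
    { obj := fun G => ⨁ fun _ : G.V => X
      map := fun {_ G₂} h =>
        biproduct.desc fun x => biproduct.ι (fun _ : G₂.V => X) (h.toFun x)
      map_id := fun G => by
        refine biproduct.hom_ext' _ _ fun x => ?_
        rw [biproduct.ι_desc, Category.comp_id]
        rfl
      map_comp := fun h k => by
        refine biproduct.hom_ext' _ _ fun x => ?_
        rw [biproduct.ι_desc, biproduct.ι_desc_assoc, biproduct.ι_desc]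
        rfl }
  vertexObj _ _ := X
  vertexObj_simple _ _ := hX
  objIso _ := Iso.refl _
  map_vertex h x := by
    have := hX
    exact ⟨𝟙 X, id_nonzero X, by simp⟩

theorem HypergraphEmbedding.faithful (Φ : HypergraphEmbedding.{w} C) : Φ.functor.Faithful where
  map_injective {G₁ G₂} h k hhk := by
    refine DirHypergraph.Hom.ext (funext fun x => ?_)
    obtain ⟨a, ha, ea⟩ := Φ.map_vertex h x
    obtain ⟨b, -, eb⟩ := Φ.map_vertex k x
    by_contra hne
    rw [hhk, eb] at ea
    -- The nonzero component into `X_{h(x)}` would factor through the summand `X_{k(x)}`.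
    have := congr($ea ≫ biproduct.π _ (h.toFun x))
    rw [Category.assoc, Category.assoc, biproduct.ι_π_self,
      biproduct.ι_π_ne _ (Ne.symm hne)] at this
    exact ha (by simpa using this.symm)

/-- By Schur's lemma the components of `Φ(h)` are isomorphisms; if `h` is injective, their
inverses assemble to a retraction of `Φ(h)`. -/
theorem HypergraphEmbedding.mono_map (Φ : HypergraphEmbedding.{w} C) {G₁ G₂ : DirHypergraph.{w}}
    (h : G₁ ⟶ G₂) (hh : Function.Injective h.toFun) : Mono (Φ.functor.map h) := by
  classical
  cases nonempty_fintype G₁.V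
  choose a ha ea using fun x => Φ.map_vertex h x
  have hiso (x : G₁.V) : IsIso (a x) := by
    have := Φ.vertexObj_simple G₁ x
    have := Φ.vertexObj_simple G₂ (h.toFun x)
    exact isIso_of_hom_simple (ha x)
  let r : (⨁ Φ.vertexObj G₂) ⟶ ⨁ Φ.vertexObj G₁ :=
    ∑ x, biproduct.π (Φ.vertexObj G₂) (h.toFun x) ≫ inv (a x) ≫ biproduct.ι (Φ.vertexObj G₁) x
  have key : ((Φ.objIso G₁).inv ≫ Φ.functor.map h ≫ (Φ.objIso G₂).hom) ≫ r = 𝟙 _ := by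
    refine biproduct.hom_ext' _ _ fun x => ?_
    rw [← Category.assoc, ea, Category.assoc, Preadditive.comp_sum, Finset.sum_eq_single x]
    · simp
    · intro y _ hy
      rw [biproduct.ι_π_ne_assoc _ (fun e => hy (hh e).symm), zero_comp]
    · simp
  have hm : Φ.functor.map h ≫ ((Φ.objIso G₂).hom ≫ r ≫ (Φ.objIso G₁).inv) = 𝟙 _ := by
    rw [← cancel_epi (Φ.objIso G₁).inv]
    simpa using congr($key ≫ (Φ.objIso G₁).inv)
  exact (SplitMono.mk _ hm).mono

end Embedding

/-! ### The linear category of matrices graded by a set of labels -/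

/-- An object of the free additive `ℂ`-linear category on the set `V`: the formal direct sum of a
finite family of elements of `V`. -/
structure FormalSum (V : Type w) : Type w where
  size : ℕ
  label : Fin size → V

namespace FormalSum

variable {V : Type w}

/-- The matrices whose `(i, j)` entry vanishes unless the `i`-th label of the source equals the
`j`-th label of the target. -/
def homs (A B : FormalSum V) : Submodule ℂ (Matrix (Fin A.size) (Fin B.size) ℂ) where
  carrier := {M | ∀ i j, A.label i ≠ B.label j → M i j = 0}
  add_mem' hM hN i j hij := by simp [hM i j hij, hN i j hij]
  zero_mem' i j _ := rfl
  smul_mem' c M hM i j hij := by simp [hM i j hij]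

instance : Category (FormalSum V) where
  Hom A B := homs A B
  id A := ⟨1, fun _ _ hij => Matrix.one_apply_ne fun e => hij (congrArg A.label e)⟩
  comp {A B D} M N := ⟨M.1 * N.1, fun i k hik => by
    rw [Matrix.mul_apply]
    refine Finset.sum_eq_zero fun j _ => ?_
    by_cases hij : A.label i = B.label j
    · rw [N.2 j k fun e => hik (hij.trans e), mul_zero]
    · rw [M.2 i j hij, zero_mul]⟩
  id_comp M := Subtype.ext (Matrix.one_mul M.1)
  comp_id M := Subtype.ext (Matrix.mul_one M.1)
  assoc M N K := Subtype.ext (Matrix.mul_assoc M.1 N.1 K.1)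

instance : Preadditive (FormalSum V) where
  homGroup A B := inferInstanceAs (AddCommGroup (homs A B))
  add_comp _ _ _ M M' N := Subtype.ext (Matrix.add_mul M.1 M'.1 N.1)
  comp_add _ _ _ M N N' := Subtype.ext (Matrix.mul_add M.1 N.1 N'.1)

instance : Linear ℂ (FormalSum V) where
  homModule A B := inferInstanceAs (Module ℂ (homs A B))
  smul_comp _ _ _ c M N := Subtype.ext (Matrix.smul_mul c M.1 N.1)
  comp_smul _ _ _ M c N := Subtype.ext (Matrix.mul_smul M.1 c N.1)

/-- The matrix entries of a morphism. -/
def entry {A B : FormalSum V} (M : A ⟶ B) (i : Fin A.size) (j : Fin B.size) : ℂ := M.1 i j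

theorem entry_eq_zero {A B : FormalSum V} (M : A ⟶ B) {i : Fin A.size} {j : Fin B.size}
    (h : A.label i ≠ B.label j) : entry M i j = 0 :=
  M.2 i j h

@[ext]
theorem hom_ext {A B : FormalSum V} {M N : A ⟶ B} (h : ∀ i j, entry M i j = entry N i j) :
    M = N :=
  Subtype.ext (Matrix.ext h)

theorem entry_id (A : FormalSum V) (i j : Fin A.size) :
    entry (𝟙 A) i j = if i = j then 1 else 0 :=
  Matrix.one_apply

theorem entry_comp {A B D : FormalSum V} (M : A ⟶ B) (N : B ⟶ D) (i : Fin A.size)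
    (k : Fin D.size) : entry (M ≫ N) i k = ∑ j, entry M i j * entry N j k :=
  Matrix.mul_apply

theorem entry_add {A B : FormalSum V} (M N : A ⟶ B) (i : Fin A.size) (j : Fin B.size) :
    entry (M + N) i j = entry M i j + entry N i j := rfl

theorem entry_smul {A B : FormalSum V} (c : ℂ) (M : A ⟶ B) (i : Fin A.size) (j : Fin B.size) :
    entry (c • M) i j = c * entry M i j := rfl

/-- Relabelling along a map of labels; it leaves the matrices unchanged. -/
def relabel {V' : Type w} (h : V → V') : FormalSum V ⥤ FormalSum V' where
  obj A := ⟨A.size, h ∘ A.label⟩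
  map M := ⟨M.1, fun i j hij => M.2 i j fun e => hij (congrArg h e)⟩

instance {V' : Type w} (h : V → V') : (relabel h).Additive where

instance {V' : Type w} (h : V → V') : (relabel h).Linear ℂ where

end FormalSum

/-! ### Realizing formal sums by direct sums of labels -/

namespace LabelledHypergraph

variable {C : Type u} [Category.{v} C] [Abelian C] (L : LabelledHypergraph.{w} C)

open Classical in
/-- The identity of `X_x` if `x = y`, and zero otherwise. -/
noncomputable def delta (x y : L.graph.V) : L.label x ⟶ L.label y :=
  if h : x = y then eqToHom (congrArg L.label h) else 0

theorem delta_self (x : L.graph.V) : L.delta x x = 𝟙 _ := by simp [delta]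

variable [Linear ℂ C]

theorem smul_delta_comp {x y z : L.graph.V} {c d : ℂ} (hc : x ≠ y → c = 0) :
    (c • L.delta x y) ≫ (d • L.delta y z) = (c * d) • L.delta x z := by
  by_cases hxy : x = y
  · subst hxy
    rw [delta_self, Linear.smul_comp, Category.id_comp, smul_smul]
  · rw [hc hxy, zero_smul, zero_comp, zero_mul, zero_smul]

theorem smul_delta_injective {x y : L.graph.V} {c d : ℂ} (hc : x ≠ y → c = 0)
    (hd : x ≠ y → d = 0) (h : c • L.delta x y = d • L.delta x y) : c = d := by
  by_cases hxy : x = y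
  · subst hxy
    have := L.simple x
    rw [delta_self] at h
    exact smul_left_injective ℂ (id_nonzero (L.label x)) h
  · rw [hc hxy, hd hxy]

theorem exists_eq_smul_delta (hfin : ∀ x, FiniteDimensional ℂ (L.label x ⟶ L.label x))
    {x y : L.graph.V} (f : L.label x ⟶ L.label y) :
    ∃ c : ℂ, (x ≠ y → c = 0) ∧ f = c • L.delta x y := by
  by_cases hxy : x = y
  · subst hxy
    have := hfin x
    obtain ⟨c, hc⟩ := exists_eq_smul_id_of_simple (L.simple x) f
    exact ⟨c, fun h => absurd rfl h, by rw [delta_self, hc]⟩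
  · exact ⟨0, fun _ => rfl, by rw [L.hom_eq_zero hxy f, zero_smul]⟩

/-- The functor that realizes a formal sum of vertices as the direct sum of their labels, and a
matrix as the morphism with these scalar components. -/
noncomputable def realize : FormalSum L.graph.V ⥤ L.Subcat where
  obj A := ⟨⨁ fun i => L.label (A.label i), A.size, A.label, ⟨Iso.refl _⟩⟩
  map {A B} M := ObjectProperty.homMk
    (biproduct.matrix fun i j => FormalSum.entry M i j • L.delta (A.label i) (B.label j))
  map_id A := by
    ext1
    refine biproduct.hom_ext _ _ fun j => biproduct.hom_ext' _ _ fun i => ?_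
    change _ ≫ biproduct.matrix _ ≫ _ = _ ≫ 𝟙 _ ≫ _
    rw [biproduct.matrix_π, biproduct.ι_desc, Category.id_comp]
    by_cases hij : i = j
    · subst hij
      rw [FormalSum.entry_id, if_pos rfl, delta_self, one_smul, biproduct.ι_π_self]
    · rw [FormalSum.entry_id, if_neg hij, zero_smul, biproduct.ι_π_ne _ hij]
  map_comp {A B D} M N := by
    ext1
    refine biproduct.hom_ext _ _ fun k => biproduct.hom_ext' _ _ fun i => ?_
    change _ ≫ biproduct.matrix _ ≫ _ = _ ≫ (biproduct.matrix _ ≫ biproduct.matrix _) ≫ _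
    rw [biproduct.matrix_π, biproduct.ι_desc, Category.assoc, biproduct.matrix_π,
      biproduct.ι_matrix_assoc, biproduct.lift_desc]
    simp only [L.smul_delta_comp (FormalSum.entry_eq_zero M), ← Finset.sum_smul,
      FormalSum.entry_comp]

variable {L} {A B : FormalSum L.graph.V}

/-- The component of a morphism between direct sums of labels at a pair of summands. -/
noncomputable def component (f : L.realize.obj A ⟶ L.realize.obj B) (i : Fin A.size)
    (j : Fin B.size) : L.label (A.label i) ⟶ L.label (B.label j) :=
  let f' : (⨁ fun i => L.label (A.label i)) ⟶ ⨁ fun j => L.label (B.label j) := f.hom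
  biproduct.ι (fun i => L.label (A.label i)) i ≫ f' ≫ biproduct.π (fun j => L.label (B.label j)) j

theorem hom_ext_component {f g : L.realize.obj A ⟶ L.realize.obj B}
    (h : ∀ i j, component f i j = component g i j) : f = g := by
  ext1
  exact biproduct.hom_ext _ _ fun j => biproduct.hom_ext' _ _ fun i => h i j

theorem component_realize_map (M : A ⟶ B) (i : Fin A.size) (j : Fin B.size) :
    component (L.realize.map M) i j =
      FormalSum.entry M i j • L.delta (A.label i) (B.label j) := by
  change biproduct.ι (fun i => L.label (A.label i)) i ≫ biproduct.matrix _ ≫ _ = _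
  rw [biproduct.matrix_π, biproduct.ι_desc]

theorem component_add (f g : L.realize.obj A ⟶ L.realize.obj B) (i : Fin A.size)
    (j : Fin B.size) : component (f + g) i j = component f i j + component g i j :=
  (congrArg _ (Preadditive.add_comp _ _ _ _ _ _)).trans (Preadditive.comp_add _ _ _ _ _ _)

theorem component_smul (c : ℂ) (f : L.realize.obj A ⟶ L.realize.obj B) (i : Fin A.size)
    (j : Fin B.size) : component (c • f) i j = c • component f i j :=
  (congrArg _ (Linear.smul_comp _ _ _ _ _ _)).trans (Linear.comp_smul _ _ _ _ _ _)

variable (L)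

instance : L.realize.Additive where
  map_add {A B M N} := hom_ext_component fun i j => by
    simp only [component_add, component_realize_map, FormalSum.entry_add, add_smul]

instance : L.realize.Linear ℂ where
  map_smul {A B} M c := hom_ext_component fun i j => by
    simp only [component_smul, component_realize_map, FormalSum.entry_smul, smul_smul]

instance : L.realize.Faithful where
  map_injective {A B} M N h := FormalSum.hom_ext fun i j => by
    refine L.smul_delta_injective (FormalSum.entry_eq_zero M) (FormalSum.entry_eq_zero N) ?_
    rw [← component_realize_map, ← component_realize_map, h]

instance : L.realize.EssSurj where
  mem_essImage := by
    rintro ⟨Y, n, f, ⟨e⟩⟩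
    exact ⟨⟨n, f⟩, ⟨ObjectProperty.isoMk _ e.symm⟩⟩

theorem realize_full (hfin : ∀ x, FiniteDimensional ℂ (L.label x ⟶ L.label x)) :
    L.realize.Full where
  map_surjective {A B} f := by
    choose M hM eM using fun i j => L.exists_eq_smul_delta hfin (component f i j)
    refine ⟨⟨M, hM⟩, hom_ext_component fun i j => ?_⟩
    rw [component_realize_map, eM]
    rfl

/-- Schur's lemma makes `C_G` equivalent to the category of matrices graded by the vertices. -/
theorem realize_isEquivalence (hfin : ∀ x, FiniteDimensional ℂ (L.label x ⟶ L.label x)) :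
    L.realize.IsEquivalence :=
  have := L.realize_full hfin
  {}

end LabelledHypergraph

/-! ### Embeddings with values in subcategories -/

section Subcategory

variable {C : Type u} [Category.{v} C] [Abelian C] [Linear ℂ C]

/-- The subcategory embedding given by relabelling the direct summands: under the equivalence of
`C_G` with the category of graded matrices, `Φ(h)` leaves the matrices unchanged. -/
noncomputable def SubcategoryEmbedding.ofRelabel
    (hfin : ∀ X : C, Simple X → FiniteDimensional ℂ (X ⟶ X)) :
    SubcategoryEmbedding.{w} C :=
  have (L : LabelledHypergraph.{w} C) : L.realize.IsEquivalence :=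
    L.realize_isEquivalence fun x => hfin _ (L.simple x)
  let E (L : LabelledHypergraph.{w} C) : FormalSum L.graph.V ≌ L.Subcat := L.realize.asEquivalence
  have (L : LabelledHypergraph.{w} C) : (E L).functor.Additive :=
    inferInstanceAs L.realize.Additive
  have (L : LabelledHypergraph.{w} C) : (E L).functor.Linear ℂ :=
    inferInstanceAs (L.realize.Linear ℂ)
  { map := fun L₁ L₂ h => (E L₁).inverse ⋙ FormalSum.relabel h.toFun ⋙ (E L₂).functor
    additive := fun L₁ L₂ h => inferInstance
    linear := fun L₁ L₂ h => inferInstance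
    map_vertex := fun L₁ L₂ h x => by
      let s (L : LabelledHypergraph.{w} C) (y : L.graph.V) :
          (E L).functor.obj ⟨1, fun _ => y⟩ ≅ L.vertexObj y :=
        ObjectProperty.isoMk _ (biproductUniqueIso (fun _ : Fin 1 => L.label y))
      exact ⟨(E L₂).functor.mapIso ((FormalSum.relabel h.toFun).mapIso
        ((E L₁).inverse.mapIso (s L₁ x).symm ≪≫ ((E L₁).unitIso.app _).symm)) ≪≫
          s L₂ (h.toFun x)⟩
    map_id := fun L => ⟨(E L).counitIso⟩
    map_comp := fun L₁ L₂ L₃ h k =>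
      ⟨Functor.isoWhiskerLeft ((E L₁).inverse ⋙ FormalSum.relabel h.toFun)
        (Functor.isoWhiskerRight (E L₂).unitIso (FormalSum.relabel k.toFun ⋙ (E L₃).functor))⟩ }

theorem SubcategoryEmbedding.hom_ext_of_iso (Φ : SubcategoryEmbedding.{w} C)
    {L₁ L₂ : LabelledHypergraph.{w} C} {h h' : L₁.graph ⟶ L₂.graph}
    (e : Φ.map L₁ L₂ h ≅ Φ.map L₁ L₂ h') : h = h' := by
  refine DirHypergraph.Hom.ext (funext fun x => ?_)
  obtain ⟨a⟩ := Φ.map_vertex L₁ L₂ h x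
  obtain ⟨b⟩ := Φ.map_vertex L₁ L₂ h' x
  exact L₂.not_iso _ _ ⟨L₂.isSum.ι.mapIso (a.symm ≪≫ e.app _ ≪≫ b)⟩

end Subcategory

/-! ### Full faithfulness of subcategory embeddings -/

section FullyFaithful

/-- If two objects are retracts of finite direct sums through the families `i, p` and `i', p'`,
an additive functor that is bijective on morphisms between the summands is bijective on
morphisms between the two objects. -/
theorem map_bijective_of_decomposition {A B : Type*} [Category A] [Category B] [Preadditive A]
    [Preadditive B] (F : A ⥤ B) [F.Additive] {Y Y' : A} {ι ι' : Type*} [Fintype ι] [Fintype ι']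
    {X : ι → A} {X' : ι' → A} (i : ∀ k, X k ⟶ Y) (p : ∀ k, Y ⟶ X k) (i' : ∀ k, X' k ⟶ Y')
    (p' : ∀ k, Y' ⟶ X' k) (hY : ∑ k, p k ≫ i k = 𝟙 Y) (hY' : ∑ k, p' k ≫ i' k = 𝟙 Y')
    (hF : ∀ k l, Function.Bijective (F.map : (X k ⟶ X' l) → _)) :
    Function.Bijective (F.map : (Y ⟶ Y') → _) := by
  have expand (f : Y ⟶ Y') : f = ∑ k, ∑ l, p k ≫ (i k ≫ f ≫ p' l) ≫ i' l := by
    calc f = (∑ k, p k ≫ i k) ≫ f ≫ ∑ l, p' l ≫ i' l := by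
          rw [hY, hY', Category.id_comp, Category.comp_id]
      _ = _ := by
          simp only [Preadditive.sum_comp, Preadditive.comp_sum, Category.assoc]
          exact Finset.sum_comm
  have expandF (g : F.obj Y ⟶ F.obj Y') :
      g = ∑ k, ∑ l, F.map (p k) ≫ (F.map (i k) ≫ g ≫ F.map (p' l)) ≫ F.map (i' l) := by
    calc g = F.map (∑ k, p k ≫ i k) ≫ g ≫ F.map (∑ l, p' l ≫ i' l) := by
          rw [hY, hY', F.map_id, F.map_id, Category.id_comp, Category.comp_id]
      _ = _ := by
          simp only [F.map_sum, F.map_comp, Preadditive.sum_comp, Preadditive.comp_sum,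
            Category.assoc]
          exact Finset.sum_comm
  constructor
  · intro f g hfg
    rw [expand f, expand g]
    refine Finset.sum_congr rfl fun k _ => Finset.sum_congr rfl fun l _ => ?_
    congr 2
    refine (hF k l).1 ?_
    simp only [F.map_comp, hfg]
  · intro g
    choose m hm using fun k l => (hF k l).2 (F.map (i k) ≫ g ≫ F.map (p' l))
    refine ⟨∑ k, ∑ l, p k ≫ m k l ≫ i' l, ?_⟩
    simp only [F.map_sum, F.map_comp, hm]
    exact (expandF g).symm

variable {C : Type u} [Category.{v} C] [Abelian C]

/-- Every object of `C_G` is a finite direct sum of labels, and the structure morphisms of the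
direct sum lie in `C_G`. -/
theorem LabelledHypergraph.exists_decomposition (L : LabelledHypergraph.{w} C) (Y : L.Subcat) :
    ∃ (n : ℕ) (f : Fin n → L.graph.V) (i : ∀ k, L.vertexObj (f k) ⟶ Y)
      (p : ∀ k, Y ⟶ L.vertexObj (f k)), ∑ k, p k ≫ i k = 𝟙 Y := by
  obtain ⟨Y, n, f, ⟨e⟩⟩ := Y
  refine ⟨n, f, fun k => ObjectProperty.homMk (biproduct.ι (fun k => L.label (f k)) k ≫ e.inv),
    fun k => ObjectProperty.homMk (e.hom ≫ biproduct.π (fun k => L.label (f k)) k),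
    L.isSum.ι.map_injective ?_⟩
  rw [Functor.map_sum]
  change ∑ k, (e.hom ≫ biproduct.π (fun k => L.label (f k)) k) ≫
    (biproduct.ι (fun k => L.label (f k)) k ≫ e.inv) = 𝟙 Y
  have total : ∑ k, biproduct.π (fun k => L.label (f k)) k ≫
      biproduct.ι (fun k => L.label (f k)) k = 𝟙 _ := biproduct.total
  simpa only [Preadditive.comp_sum, Preadditive.sum_comp, Category.id_comp, Category.assoc,
    Iso.hom_inv_id] using congr(e.hom ≫ $total ≫ e.inv)

theorem LabelledHypergraph.vertexObj_hom_eq_zero (L : LabelledHypergraph.{w} C)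
    {x y : L.graph.V} (hxy : x ≠ y) (f : L.vertexObj x ⟶ L.vertexObj y) : f = 0 :=
  L.isSum.ι.map_injective (L.hom_eq_zero hxy f.hom)

theorem LabelledHypergraph.id_vertexObj_ne_zero (L : LabelledHypergraph.{w} C)
    (x : L.graph.V) : 𝟙 (L.vertexObj x) ≠ 0 := fun h =>
  have := L.simple x
  id_nonzero (L.label x) congr(($h).hom)

variable [Linear ℂ C]

theorem LabelledHypergraph.vertexObj_end_eq_smul_id (L : LabelledHypergraph.{w} C)
    {x : L.graph.V} [FiniteDimensional ℂ (L.label x ⟶ L.label x)]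
    (f : L.vertexObj x ⟶ L.vertexObj x) : ∃ c : ℂ, f = c • 𝟙 _ := by
  obtain ⟨c, hc⟩ := exists_eq_smul_id_of_simple (L.simple x) f.hom
  exact ⟨c, L.isSum.ι.map_injective hc⟩

/-- On labels, `Φ(h)` is bijective on morphisms when `h` is injective: both sides are zero for
distinct vertices, and both consist of the multiples of the identity for equal ones. -/
theorem SubcategoryEmbedding.map_bijective_vertexObj (Φ : SubcategoryEmbedding.{w} C)
    (hfin : ∀ X : C, Simple X → FiniteDimensional ℂ (X ⟶ X))
    {L₁ L₂ : LabelledHypergraph.{w} C} (h : L₁.graph ⟶ L₂.graph)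
    (hh : Function.Injective h.toFun) (x y : L₁.graph.V) :
    Function.Bijective
      ((Φ.map L₁ L₂ h).map : (L₁.vertexObj x ⟶ L₁.vertexObj y) → _) := by
  have := Φ.additive L₁ L₂ h
  have := Φ.linear L₁ L₂ h
  obtain ⟨a⟩ := Φ.map_vertex L₁ L₂ h x
  by_cases hxy : x = y
  · subst hxy
    have := hfin _ (L₁.simple x)
    have := hfin _ (L₂.simple (h.toFun x))
    constructor
    · intro f g hfg
      obtain ⟨c, rfl⟩ := L₁.vertexObj_end_eq_smul_id f
      obtain ⟨d, rfl⟩ := L₁.vertexObj_end_eq_smul_id g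
      simp only [Functor.map_smul, CategoryTheory.Functor.map_id] at hfg
      have key : c • 𝟙 (L₂.vertexObj (h.toFun x)) = d • 𝟙 _ := by
        simpa using congr(a.inv ≫ $hfg ≫ a.hom)
      rw [smul_left_injective ℂ (L₂.id_vertexObj_ne_zero _) key]
    · intro g
      obtain ⟨c, hc⟩ := L₂.vertexObj_end_eq_smul_id (a.inv ≫ g ≫ a.hom)
      refine ⟨c • 𝟙 _, ?_⟩
      rw [Functor.map_smul, CategoryTheory.Functor.map_id]
      simpa using congr(a.hom ≫ $hc ≫ a.inv).symm
  · obtain ⟨b⟩ := Φ.map_vertex L₁ L₂ h y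
    constructor
    · intro f g _
      rw [L₁.vertexObj_hom_eq_zero hxy f, L₁.vertexObj_hom_eq_zero hxy g]
    · intro g
      refine ⟨0, ?_⟩
      have hg := L₂.vertexObj_hom_eq_zero (fun e => hxy (hh e)) (a.inv ≫ g ≫ b.hom)
      rw [Functor.map_zero]
      simpa using congr(a.hom ≫ $hg ≫ b.inv).symm

theorem SubcategoryEmbedding.map_bijective (Φ : SubcategoryEmbedding.{w} C)
    (hfin : ∀ X : C, Simple X → FiniteDimensional ℂ (X ⟶ X))
    {L₁ L₂ : LabelledHypergraph.{w} C} (h : L₁.graph ⟶ L₂.graph)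
    (hh : Function.Injective h.toFun) (Y Y' : L₁.Subcat) :
    Function.Bijective ((Φ.map L₁ L₂ h).map : (Y ⟶ Y') → _) := by
  have := Φ.additive L₁ L₂ h
  obtain ⟨_, _, i, p, hY⟩ := L₁.exists_decomposition Y
  obtain ⟨_, _, i', p', hY'⟩ := L₁.exists_decomposition Y'
  exact map_bijective_of_decomposition _ i p i' p' hY hY'
    fun _ _ => Φ.map_bijective_vertexObj hfin h hh _ _

end FullyFaithful

end DataFabric

theorem mainTheorem4 (C : Type u) [Category.{v} C] [Abelian C] [Linear ℂ C]
    [MonoidalCategory C] [MonoidalPreadditive C] [MonoidalLinear ℂ C] [BraidedCategory C]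
    [RigidCategory C] [RibbonCategory C] [ModularTensorCategory C] :
    (∀ X : C, Simple X →
      ∃ Φ : HypergraphEmbedding.{w} C, ∀ (G : DirHypergraph.{w}) (x : G.V),
        Φ.vertexObj G x = X) ∧
    (∀ Φ : HypergraphEmbedding.{w} C,
      Φ.functor.Faithful ∧
      ∀ (G₁ G₂ : DirHypergraph.{w}) (h : G₁ ⟶ G₂),
        Function.Injective h.toFun → Mono (Φ.functor.map h)) ∧
    Nonempty (SubcategoryEmbedding.{w} C) ∧
    (∀ (Φ : SubcategoryEmbedding.{w} C) (L₁ L₂ : LabelledHypergraph.{w} C)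
      (h : L₁.graph ⟶ L₂.graph),
      (∀ h' : L₁.graph ⟶ L₂.graph, Nonempty (Φ.map L₁ L₂ h ≅ Φ.map L₁ L₂ h') → h = h') ∧
      (Function.Injective h.toFun → (Φ.map L₁ L₂ h).Full ∧ (Φ.map L₁ L₂ h).Faithful)) := by
  have hfin (X : C) (_ : Simple X) : FiniteDimensional ℂ (X ⟶ X) :=
    ModularTensorCategory.finiteDimensional_hom X X
  refine ⟨fun X hX => ⟨.const X hX, fun _ _ => rfl⟩, fun Φ => ⟨Φ.faithful, fun _ _ => Φ.mono_map⟩,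
    ⟨.ofRelabel hfin⟩, fun Φ L₁ L₂ h => ⟨fun _ ⟨e⟩ => Φ.hom_ext_of_iso e, fun hh => ⟨?_, ?_⟩⟩⟩
  · exact ⟨fun {Y Y'} => (Φ.map_bijective hfin h hh Y Y').2⟩
  · exact ⟨fun {Y Y'} => (Φ.map_bijective hfin h hh Y Y').1⟩
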